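/- Let $V$ be a discrete valuation domain (not a field) with finite residue field and let $K$ be its quotient field. Suppose that there is a valuation ring $W$ of $K$ that is independent from $V$ (that is, the only valuation ring of $K$ containing both $V$ and $W$ is $K$ itself) and such that the maximal ideal of $W$ is nonzero and principal, or the residue field of $W$ is finite. Let $\operatorname{Int}(V)=\{f\in K[X] \mid f(V)\subseteq V\}$ be the ring of integer-valued polynomials on $V$. A factorization of $H\in\operatorname{Int}(V)$ of length $n$ is a decomposition $H=a_1\cdots a_n$ into irreducible elements $a_i$ of $\operatorname{Int}(V)$. Two factorizations $a_1\cdots a_n=u_1\cdots u_m$ of $H$ are called essentially the same if $n=m$ and, after re-indexing, each $u_i$ is a unit of $\operatorname{Int}(V)$ times $a_i$; otherwise they are essentially different. Then for every positive integer $k$ and all integers $1<n_1\le\dots\le n_k$ there exists $H\in\operatorname{Int}(V)$ that has precisely $k$ essentially different factorizations into irreducible elements of $\operatorname{Int}(V)$, and their lengths are exactly $n_1,\dots,n_k$. That is, there are factorizations $\varphi_1,\dots,\varphi_k$ of $H$, pairwise essentially different, with $\varphi_i$ of length $n_i$ for each $i$, such that every factorization of $H$ is essentially the same as one of them. -/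

import Mathlib

open Polynomial

/-- The ring `Int(V) = {f ∈ K[X] | f(V) ⊆ V}` of integer-valued polynomials on a domain `V` with
quotient field `K` (`V` is identified with its image in `K`). -/
def integerValuedPolynomials (V K : Type*) [CommRing V] [Field K] [Algebra V K] :
    Subring K[X] where
  carrier := {f | ∀ a : V, f.eval (algebraMap V K a) ∈ (algebraMap V K).range}
  mul_mem' := fun hf hg a => by
    rw [eval_mul]
    exact Subring.mul_mem _ (hf a) (hg a)
  one_mem' := fun a => by
    rw [eval_one]
    exact Subring.one_mem _
  add_mem' := fun hf hg a => by
    rw [eval_add]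
    exact Subring.add_mem _ (hf a) (hg a)
  zero_mem' := fun a => by
    rw [eval_zero]
    exact Subring.zero_mem _
  neg_mem' := fun hf a => by
    rw [eval_neg]
    exact Subring.neg_mem _ (hf a)

/-- A valuation ring `W` of `K` is independent from the valuation ring `V` with quotient field `K`
if the only valuation ring of `K` containing both `V` and `W` is the field `K` itself. -/
def IsIndependentFrom (V : Type*) {K : Type*} [CommRing V] [Field K] [Algebra V K]
    (W : ValuationSubring K) : Prop :=
  ∀ U : ValuationSubring K, (algebraMap V K).range ≤ U.toSubring → W ≤ U → U = ⊤

/-- The multiset `s` is a factorization of `r`: all members of `s` are irreducible and their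
product is `r`. The length of the factorization is `Multiset.card s`. -/
def IsFactorization {R : Type*} [CommRing R] (r : R) (s : Multiset R) : Prop :=
  (∀ a ∈ s, Irreducible a) ∧ s.prod = r

/-- Two factorizations are essentially the same if, after re-indexing, corresponding members are
associated (in particular, they have the same length). -/
def EssentiallySame {R : Type*} [CommRing R] (s t : Multiset R) : Prop :=
  Multiset.Rel Associated s t

/-! Let `ϖ` be a uniformizer of `V`. Take blocks of sizes `n i - 1`, one polynomial `f x` for each
block element `x`, and a distinguished polynomial `f₀`, all irreducible over `K` and of distinct
degrees. Arrange their zeros modulo the maximal ideal so that for `x`, `y` in different blocks some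
point is a zero of `f x` and `f y` only, while every point not of this kind is a zero of `f₀`. Then
`ϖ` divides `f₀ * ∏ x ∈ A, f x` exactly when the indices missing from `A` lie in one block.

Put `H = f₀ * ∏ f x / ϖ`. At a suitable point every `f x` is a unit and `f₀` has valuation at most
one, so in any factorization the denominator `ϖ` stays with `f₀`. The factor containing `f₀` must
omit indices from one block only, and by irreducibility it omits that whole block. The omitted `f x`
are irreducible and form the other factors. Hence there is one factorization per block, of length
`(n i - 1) + 1` (`exists_fiberwise_eq'`, `exists_factorizations_of_blocks`).

To realize the incidence pattern, Lagrange interpolation on representatives modulo a power of the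
maximal ideal gives integer-valued polynomials with prescribed zeros (`exists_evalAt_sub_mem`); here
the residue field of `V` must be finite. Adding elements of `ϖ ^ 2 V[X]` preserves the pattern.
Since `W` is independent from `V`, such a perturbation can also make the polynomial, up to a scalar,
Eisenstein over `W` or irreducible modulo the maximal ideal of `W`, in any larger degree
(`exists_irreducible_sub_coeff_mem`). -/

/-! ### Residue classes of irreducible monic polynomials over a local domain -/

theorem exists_monic_irreducible_of_natDegree (F : Type*) [Field F] [Finite F] {n : ℕ}
    (hn : n ≠ 0) : ∃ p : F[X], p.Monic ∧ Irreducible p ∧ p.natDegree = n := by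
  have : NeZero n := ⟨hn⟩
  obtain ⟨p, hp⟩ := CharP.exists F
  have : Fact p.Prime := ⟨CharP.char_is_prime F p⟩
  obtain ⟨α, hα⟩ := Field.exists_primitive_element_of_finite_bot F (FiniteField.Extension F p n)
  have hint : IsIntegral F α := Algebra.IsIntegral.isIntegral α
  refine ⟨minpoly F α, minpoly.monic hint, minpoly.irreducible hint, ?_⟩
  rw [(Field.primitive_element_iff_minpoly_natDegree_eq F α).1 hα,
    FiniteField.finrank_extension F p n]

/-- Over a local domain whose maximal ideal is principal or whose residue field is finite there
are residue classes of monic polynomials of any given degree all of whose members are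
irreducible. -/
theorem exists_forall_monic_irreducible {R : Type*} [CommRing R] [IsDomain R] [IsLocalRing R]
    (hbot : IsLocalRing.maximalIdeal R ≠ ⊥)
    (h : (IsLocalRing.maximalIdeal R).IsPrincipal ∨ Finite (IsLocalRing.ResidueField R))
    {n : ℕ} (hn : n ≠ 0) :
    ∃ T : R[X], ∃ d ∈ IsLocalRing.maximalIdeal R, d ≠ 0 ∧
      ∀ Q : R[X], Q.Monic → Q.natDegree = n → (∀ i < n, d ∣ Q.coeff i - T.coeff i) →
        Irreducible Q := by
  rcases h with ⟨t, ht⟩ | h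
  · rw [Ideal.submodule_span_eq] at ht
    have ht0 : t ≠ 0 := by
      rintro rfl
      exact hbot (by simpa using ht)
    have htm : t ∈ IsLocalRing.maximalIdeal R := by
      rw [ht]
      exact Ideal.mem_span_singleton_self t
    -- Eisenstein: congruence to `C t` modulo `t ^ 2` puts all lower coefficients in `(t)` and keeps
    -- the constant one out of `(t ^ 2)`.
    refine ⟨C t, t ^ 2, Ideal.pow_mem_of_mem _ htm 2 two_pos, pow_ne_zero 2 ht0,
      fun Q hQ hdeg hcoeff => ?_⟩
    have hprime : (IsLocalRing.maximalIdeal R).IsPrime := inferInstance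
    refine irreducible_of_eisenstein_criterion hprime ?_ ?_ ?_ ?_ hQ.isPrimitive
    · rw [hQ.leadingCoeff]
      exact fun h1 => hprime.ne_top ((Ideal.eq_top_iff_one _).2 h1)
    · intro i hi
      have hi : i < n := by
        rw [degree_eq_natDegree hQ.ne_zero, hdeg] at hi
        exact_mod_cast hi
      have h1 := hcoeff i hi
      rw [ht, Ideal.mem_span_singleton]
      have h2 : t ∣ (C t).coeff i := by
        rw [coeff_C]
        split_ifs <;> simp
      exact (dvd_iff_dvd_of_dvd_sub ((dvd_pow_self t two_ne_zero).trans h1)).2 h2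
    · rw [← natDegree_pos_iff_degree_pos, hdeg]
      exact Nat.pos_of_ne_zero hn
    · rw [ht, Ideal.span_singleton_pow, Ideal.mem_span_singleton]
      intro h1
      have h2 := hcoeff 0 (Nat.pos_of_ne_zero hn)
      rw [coeff_C_zero] at h2
      have h3 : t ^ 2 ∣ t := (dvd_iff_dvd_of_dvd_sub h2).1 h1
      obtain ⟨c, hc⟩ := h3
      have h4 : t * c = 1 := by
        apply mul_left_cancel₀ ht0
        linear_combination -hc
      have : IsUnit t := IsUnit.of_mul_eq_one _ h4
      exact (IsLocalRing.mem_maximalIdeal _).1 htm this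
  · obtain ⟨p, hp, hirr, hdeg⟩ :=
      exists_monic_irreducible_of_natDegree (IsLocalRing.ResidueField R) hn
    obtain ⟨T, hT⟩ := Polynomial.map_surjective (IsLocalRing.residue R)
      IsLocalRing.residue_surjective p
    obtain ⟨d, hd, hd0⟩ := Submodule.exists_mem_ne_zero_of_ne_bot hbot
    -- Any nonzero `d` in the maximal ideal works: `Q` then reduces to the irreducible polynomial
    -- `p`.
    refine ⟨T, d, hd, hd0, fun Q hQ hQdeg hcoeff => ?_⟩
    refine hQ.irreducible_of_irreducible_map (IsLocalRing.residue R) Q ?_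
    convert hirr
    ext i
    rcases lt_trichotomy i n with hi | rfl | hi
    · rw [← hT, coeff_map, coeff_map, ← sub_eq_zero, ← map_sub]
      obtain ⟨c, hc⟩ := hcoeff i hi
      rw [hc, IsLocalRing.residue_eq_zero_iff]
      exact Ideal.mul_mem_right _ _ hd
    · have h1 : Q.coeff Q.natDegree = 1 := hQ
      have h2 : p.coeff p.natDegree = 1 := hp
      rw [hQdeg] at h1
      rw [hdeg] at h2
      rw [coeff_map, h1, h2, map_one]
    · rw [coeff_eq_zero_of_natDegree_lt (hdeg.trans_lt hi), coeff_map,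
        coeff_eq_zero_of_natDegree_lt (hQdeg.trans_lt hi), map_zero]

/-! ### Approximation for two independent valuation rings -/

section Approximation

variable {V K : Type*} [CommRing V] [IsDomain V] [IsDiscreteValuationRing V]
  [Field K] [Algebra V K] [IsFractionRing V K]

/-- Otherwise `V` itself is a valuation ring containing both, so `V = K`, but a discrete valuation
ring is not a field. -/
theorem exists_mem_algebraMap_not_mem_of_isIndependentFrom {W : ValuationSubring K}
    (hW : IsIndependentFrom V W) : ∃ b ∈ W, b ∉ (algebraMap V K).range := by
  by_contra! hcon
  let U : ValuationSubring K :=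
    { (algebraMap V K).range with
      mem_or_inv_mem' := fun x => ValuationRing.isInteger_or_isInteger V x }
  have hU : U = ⊤ := hW U le_rfl hcon
  refine IsDiscreteValuationRing.not_isField V ?_
  refine (MulEquiv.ofBijective (algebraMap V K)
    ⟨IsFractionRing.injective V K, fun x => ?_⟩).isField (Field.toIsField K)
  have : x ∈ U := hU ▸ ValuationSubring.mem_top x
  exact this

/-- If the maximal ideal were zero, `W` would be finite, hence integral over `ℤ`, hence contained in
the integrally closed ring `V`. -/
theorem maximalIdeal_ne_bot_of_finite_residueField {W : ValuationSubring K}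
    (hW : IsIndependentFrom V W) (h : Finite (IsLocalRing.ResidueField W)) :
    IsLocalRing.maximalIdeal W ≠ ⊥ := by
  intro hbot
  have hinj : Function.Injective (IsLocalRing.residue W) := by
    rw [RingHom.injective_iff_ker_eq_bot, IsLocalRing.ker_residue, hbot]
  have : Finite W := Finite.of_injective _ hinj
  obtain ⟨b, hb, hbV⟩ := exists_mem_algebraMap_not_mem_of_isIndependentFrom hW
  have h1 : IsIntegral ℤ (⟨b, hb⟩ : W) := Algebra.IsIntegral.isIntegral _
  have h2 : IsIntegral ℤ b := h1.map (W.subtype.toIntAlgHom)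
  have h3 : IsIntegral V b := h2.tower_top
  exact hbV (IsIntegrallyClosed.isIntegral_iff.1 h3)

theorem exists_pow_mul_mem_range (x : K) :
    ∃ M : ℕ, ∀ e ∈ IsLocalRing.maximalIdeal V ^ M,
      algebraMap V K e * x ∈ (algebraMap V K).range := by
  obtain ⟨a, s, hs, rfl⟩ := IsFractionRing.div_surjective (A := V) x
  have hs0 : s ≠ 0 := nonZeroDivisors.ne_zero hs
  obtain ⟨ϖ, hϖ⟩ := IsDiscreteValuationRing.exists_irreducible V
  obtain ⟨M, hM⟩ := IsDiscreteValuationRing.associated_pow_irreducible hs0 hϖ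
  refine ⟨M, fun e he => ?_⟩
  rw [hϖ.maximalIdeal_eq, Ideal.span_singleton_pow, Ideal.mem_span_singleton] at he
  obtain ⟨c, rfl⟩ := hM.dvd.trans he
  refine ⟨c * a, ?_⟩
  have : algebraMap V K s ≠ 0 := by simpa using hs0
  rw [map_mul, map_mul]
  field_simp

/-- For `b` in `W` but not in `V`, take `e = 1 / (1 + d * b ^ M)` with `M` large. Over `W` the
denominator is a unit congruent to `1` modulo `d`. Over `V`, write `e = z / (1 + z)` with `z = 1 /
(d * b ^ M)`, which is small because `b⁻¹` lies in the maximal ideal. -/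
theorem exists_algebraMap_sub_one_mem {W : ValuationSubring K} (hW : IsIndependentFrom V W)
    {d : W} (hd : d ∈ IsLocalRing.maximalIdeal W) (hd0 : d ≠ 0) (m : ℕ) :
    ∃ e ∈ IsLocalRing.maximalIdeal V ^ m, ∃ w : W, algebraMap V K e - 1 = d * w := by
  obtain ⟨b, hb, hbV⟩ := exists_mem_algebraMap_not_mem_of_isIndependentFrom hW
  obtain ⟨β, hβ⟩ : b⁻¹ ∈ (algebraMap V K).range :=
    (ValuationRing.isInteger_or_isInteger V b).resolve_left hbV
  have hb0 : b ≠ 0 := by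
    rintro rfl
    exact hbV (zero_mem _)
  have hβm : β ∈ IsLocalRing.maximalIdeal V := by
    rw [IsLocalRing.mem_maximalIdeal, mem_nonunits_iff]
    rintro ⟨u, rfl⟩
    refine hbV ⟨(u⁻¹ : Vˣ), ?_⟩
    rw [← inv_inv b, ← hβ]
    exact eq_inv_of_mul_eq_one_left (by rw [← map_mul]; simp)
  have hdK : (d : K) ≠ 0 := by simpa using hd0
  obtain ⟨ϖ, hϖ⟩ := IsDiscreteValuationRing.exists_irreducible V
  have hϖ0 : algebraMap V K ϖ ≠ 0 := by simpa using hϖ.ne_zero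
  obtain ⟨M, hM⟩ := exists_pow_mul_mem_range (V := V) ((d : K)⁻¹ * (algebraMap V K ϖ ^ (m + 1))⁻¹)
  obtain ⟨c, hc⟩ := hM (β ^ M) (Ideal.pow_mem_pow hβm M)
  -- The exponent is `m + 1` so that `z` lies in the maximal ideal, and `1 + z` is a unit, even when
  -- `m = 0`.
  set z : V := ϖ ^ (m + 1) * c with hz
  have hzm : z ∈ IsLocalRing.maximalIdeal V := by
    rw [hϖ.maximalIdeal_eq, Ideal.mem_span_singleton]
    exact (dvd_pow_self _ (Nat.succ_ne_zero m)).mul_right _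
  have hzm' : z ∈ IsLocalRing.maximalIdeal V ^ m := by
    rw [hϖ.maximalIdeal_eq, Ideal.span_singleton_pow, Ideal.mem_span_singleton]
    exact (pow_dvd_pow ϖ (Nat.le_succ m)).mul_right _
  have hzK : algebraMap V K z = (d : K)⁻¹ * (b ^ M)⁻¹ := by
    rw [hz, map_mul, hc, map_pow, map_pow, hβ, inv_pow]
    field_simp
  obtain ⟨u, hu⟩ : IsUnit (1 + z) := by
    by_contra h1
    have h2 : 1 + z ∈ IsLocalRing.maximalIdeal V := h1
    exact (Ideal.ne_top_iff_one _).1 (IsLocalRing.maximalIdeal.isMaximal V).ne_top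
      ((Ideal.add_mem_iff_left _ hzm).1 h2)
  have hy : d * (⟨b, hb⟩ : W) ^ M ∈ IsLocalRing.maximalIdeal W := Ideal.mul_mem_right _ _ hd
  obtain ⟨v, hv⟩ : IsUnit (1 + d * (⟨b, hb⟩ : W) ^ M) := by
    by_contra h1
    have h2 : 1 + d * (⟨b, hb⟩ : W) ^ M ∈ IsLocalRing.maximalIdeal W := h1
    exact (Ideal.ne_top_iff_one _).1 (IsLocalRing.maximalIdeal.isMaximal W).ne_top
      ((Ideal.add_mem_iff_left _ hy).1 h2)
  refine ⟨z * (u⁻¹ : Vˣ), Ideal.mul_mem_right _ _ hzm', -(⟨b, hb⟩ : W) ^ M * (v⁻¹ : Wˣ), ?_⟩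
  have huK : algebraMap V K (u⁻¹ : Vˣ) * (1 + algebraMap V K z) = 1 := by
    rw [← map_one (algebraMap V K), ← map_add, ← hu, ← map_mul]
    simp
  have hvK : ((v⁻¹ : Wˣ) : K) * (1 + d * b ^ M) = 1 := by
    have h1 : (v⁻¹ : Wˣ) * (1 + d * (⟨b, hb⟩ : W) ^ M) = 1 := by
      rw [← hv]
      simp
    exact congrArg (fun x : W => (x : K)) h1
  have h1 : (1 + (d : K) * b ^ M) ≠ 0 := right_ne_zero_of_mul_eq_one hvK
  have h2 : (1 + algebraMap V K z) ≠ 0 := right_ne_zero_of_mul_eq_one huK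
  rw [map_mul, eq_inv_of_mul_eq_one_left huK]
  push_cast
  rw [eq_inv_of_mul_eq_one_left hvK, hzK]
  rw [hzK] at h2
  have h4 : b ^ M ≠ 0 := pow_ne_zero _ hb0
  have h3 : 1 + (d : K)⁻¹ * (b ^ M)⁻¹ = (1 + d * b ^ M) * ((d : K)⁻¹ * (b ^ M)⁻¹) := by
    field_simp
    ring
  rw [h3]
  field_simp
  ring

/-- Simultaneous approximation with respect to a discrete valuation ring and a valuation ring
independent from it. -/
theorem exists_sub_mem_and_sub_mem {W : ValuationSubring K} (hW : IsIndependentFrom V W)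
    {d : W} (hd : d ∈ IsLocalRing.maximalIdeal W) (hd0 : d ≠ 0) {c : K} (hc : c ≠ 0)
    (x y : K) : ∃ z : K, (∃ a : V, z - x = c * algebraMap V K a) ∧ ∃ w : W, z - y = d * w := by
  obtain ⟨M, hM⟩ := exists_pow_mul_mem_range (V := V) ((y - x) * c⁻¹)
  -- `d'` is a denominator of `x - y` over `W`; requiring `e ≡ 1` modulo `d * d'` absorbs it.
  obtain ⟨d', hd', hd'W⟩ : ∃ d' : W, d' ≠ 0 ∧ (d' : K) * (x - y) ∈ W := by
    rcases W.mem_or_inv_mem (x - y) with h | h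
    · exact ⟨1, one_ne_zero, by simpa using h⟩
    · by_cases h0 : x - y = 0
      · exact ⟨1, one_ne_zero, by simp [h0]⟩
      · refine ⟨⟨_, h⟩, ?_, ?_⟩
        · intro h1
          exact inv_ne_zero h0 (congrArg (fun x : W => (x : K)) h1)
        · simp [h0]
  obtain ⟨e, he, w, hw⟩ := exists_algebraMap_sub_one_mem hW
    (Ideal.mul_mem_right d' _ hd) (mul_ne_zero hd0 hd') M
  obtain ⟨a, ha⟩ := hM e he
  refine ⟨x + algebraMap V K e * (y - x), ⟨a, ?_⟩, -w * ⟨_, hd'W⟩, ?_⟩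
  · rw [ha]
    field_simp
    ring
  · push_cast at hw ⊢
    linear_combination (y - x) * hw

/-- `Q` is a scalar `l` times a monic `S` over `W` lying in a residue class of irreducibles. The
coefficients of `S` are chosen by approximation so that those of `l * S` agree with those of `P`
modulo `c V`. Irreducibility passes from `W` to `K` by Gauss's lemma. -/
theorem exists_irreducible_sub_coeff_mem {W : ValuationSubring K} (hW : IsIndependentFrom V W)
    (h : ((IsLocalRing.maximalIdeal W).IsPrincipal ∧ IsLocalRing.maximalIdeal W ≠ ⊥) ∨
        Finite (IsLocalRing.ResidueField W)) {c : V} (hc : c ≠ 0) (P : K[X]) {n : ℕ}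
    (hn : P.natDegree < n) :
    ∃ Q : K[X], Irreducible Q ∧ Q.natDegree = n ∧
      ∃ D : V[X], Q = P + C (algebraMap V K c) * D.map (algebraMap V K) := by
  have hbot : IsLocalRing.maximalIdeal W ≠ ⊥ :=
    h.elim And.right (maximalIdeal_ne_bot_of_finite_residueField hW)
  obtain ⟨T, d, hd, hd0, hT⟩ :=
    exists_forall_monic_irreducible hbot (h.imp_left And.left) (Nat.ne_zero_of_lt hn)
  have hcK : algebraMap V K c ≠ 0 := by simpa using hc
  -- The leading coefficient `l` must be in `c V` because `P` has no term of degree `n`; closeness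
  -- to `1` in `W` ensures `l ≠ 0`.
  obtain ⟨l, ⟨a, hla⟩, w, hlw⟩ := exists_sub_mem_and_sub_mem hW hd hd0 hcK 0 1
  have hl : l ≠ 0 := by
    rintro rfl
    refine (Ideal.ne_top_iff_one _).1 (IsLocalRing.maximalIdeal.isMaximal W).ne_top ?_
    have : (1 : W) = d * -w := by
      ext
      push_cast
      linear_combination -hlw
    rw [this]
    exact Ideal.mul_mem_right _ _ hd
  -- Precision `c / l` around `P.coeff i / l` becomes precision `c` around `P.coeff i` after
  -- multiplication by `l`.
  choose q hq using fun i : ℕ => exists_sub_mem_and_sub_mem (V := V) hW hd hd0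
    (div_ne_zero hcK hl) (P.coeff i / l) (T.coeff i)
  choose A hA using fun i => (hq i).1
  choose B hB using fun i => (hq i).2
  let S : W[X] := X ^ n + ∑ i ∈ Finset.range n, C (T.coeff i + d * B i) * X ^ i
  have hSdeg : (∑ i ∈ Finset.range n, C (T.coeff i + d * B i) * X ^ i).degree < (n : WithBot ℕ) := by
    simp_rw [C_mul_X_pow_eq_monomial]
    refine (degree_sum_le _ _).trans_lt ?_
    refine (Finset.sup_lt_iff (WithBot.bot_lt_coe n)).2 fun i hi => (degree_monomial_le _ _).trans_lt (WithBot.coe_lt_coe.2 (Finset.mem_range.1 hi))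
  have hSmon : S.Monic := monic_X_pow_add hSdeg
  have hSn : S.natDegree = n := by
    rw [natDegree_add_eq_left_of_degree_lt (by rwa [degree_X_pow]), natDegree_X_pow]
  have hSirr : Irreducible S := by
    refine hT S hSmon hSn fun i hi => ⟨B i, ?_⟩
    simp only [S, coeff_add, finsetSum_coeff, coeff_C_mul, coeff_X_pow]
    simp [hi.ne, hi]
  have hSK : Irreducible (S.map (algebraMap W K)) :=
    (hSmon.irreducible_iff_irreducible_map_fraction_map (K := K)).1 hSirr
  refine ⟨C l * S.map (algebraMap W K), ?_, ?_, C a * X ^ n +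
    ∑ i ∈ Finset.range n, C (A i) * X ^ i, ?_⟩
  · rwa [irreducible_isUnit_mul (isUnit_C.2 hl.isUnit)]
  · rw [natDegree_C_mul hl, hSmon.natDegree_map, hSn]
  · conv_rhs => rw [P.as_sum_range' n hn]
    simp only [S, Polynomial.map_add, Polynomial.map_sum, Polynomial.map_mul, map_C,
      Polynomial.map_pow, map_X, mul_add, Finset.mul_sum]
    rw [add_left_comm, ← Finset.sum_add_distrib]
    congr 1
    · rw [← mul_assoc, ← C_mul, ← hla, sub_zero]
    · refine Finset.sum_congr rfl fun i _ => ?_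
      rw [← C_mul_X_pow_eq_monomial, ← mul_assoc, ← mul_assoc, ← C_mul, ← C_mul, ← add_mul, ← C_add]
      congr 2
      have h1 := hA i
      have h2 := hB i
      have h3 : algebraMap W K (T.coeff i + d * B i) = q i := by
        change ((T.coeff i + d * B i : W) : K) = q i
        push_cast
        linear_combination -h2
      rw [h3]
      field_simp at h1
      linear_combination h1

end Approximation

/-! ### Evaluation, constants and irreducibility in `Int(V)` -/

namespace integerValuedPolynomials

variable {V K : Type*} [CommRing V] [Field K] [Algebra V K] [IsFractionRing V K]

/-- Evaluation of an integer-valued polynomial at an element of `V`, as an element of `V`. -/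
noncomputable def evalAt (a : V) : integerValuedPolynomials V K →+* V where
  toFun f := (f.2 a).choose
  map_one' := IsFractionRing.injective V K <| by
    rw [(Subtype.prop (1 : integerValuedPolynomials V K) a).choose_spec]
    simp
  map_zero' := IsFractionRing.injective V K <| by
    rw [(Subtype.prop (0 : integerValuedPolynomials V K) a).choose_spec]
    simp
  map_mul' f g := IsFractionRing.injective V K <| by
    rw [(Subtype.prop (f * g) a).choose_spec, map_mul, (f.2 a).choose_spec, (g.2 a).choose_spec]
    simp
  map_add' f g := IsFractionRing.injective V K <| by
    rw [(Subtype.prop (f + g) a).choose_spec, map_add, (f.2 a).choose_spec, (g.2 a).choose_spec]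
    simp

theorem algebraMap_evalAt (a : V) (f : integerValuedPolynomials V K) :
    algebraMap V K (evalAt a f) = (f : K[X]).eval (algebraMap V K a) :=
  (f.2 a).choose_spec

theorem evalAt_eq_of_algebraMap_eq {a b : V} {f : integerValuedPolynomials V K}
    (h : algebraMap V K b = (f : K[X]).eval (algebraMap V K a)) : evalAt a f = b :=
  IsFractionRing.injective V K ((algebraMap_evalAt a f).trans h.symm)

variable (K) in
/-- The constant integer-valued polynomials. -/
noncomputable def const : V →+* integerValuedPolynomials V K :=
  (C.comp (algebraMap V K)).codRestrict _ fun b a => by simp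

@[simp]
theorem coe_const (b : V) : (const K b : K[X]) = C (algebraMap V K b) := rfl

@[simp]
theorem evalAt_const (a b : V) : evalAt a (const K b) = b :=
  evalAt_eq_of_algebraMap_eq (by simp)

theorem const_ne_zero {b : V} (hb : b ≠ 0) : const K b ≠ 0 := by
  intro h
  apply hb
  rw [← evalAt_const (K := K) 0 b, h, map_zero]

/-- An integer-valued polynomial all of whose values are divisible by `b` is divisible by the
constant `b`. -/
theorem const_dvd_of_forall_dvd_evalAt {b : V} (hb : b ≠ 0) {f : integerValuedPolynomials V K}
    (h : ∀ a, b ∣ evalAt a f) : const K b ∣ f := by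
  have hbK : algebraMap V K b ≠ 0 := by simpa using hb
  refine ⟨⟨C (algebraMap V K b)⁻¹ * f, fun a => ?_⟩, ?_⟩
  · obtain ⟨c, hc⟩ := h a
    refine ⟨c, ?_⟩
    rw [eval_mul, eval_C, ← algebraMap_evalAt, hc, map_mul, inv_mul_cancel_left₀ hbK]
  · ext1
    rw [Subring.coe_mul, coe_const, ← mul_assoc, ← C_mul, mul_inv_cancel₀ hbK, C_1, one_mul]

/-- In a factorization one factor is constant by irreducibility over `K`; it divides the unit value
at `a`, so it is a unit of `V`. -/
theorem irreducible_of_isUnit_evalAt {f : integerValuedPolynomials V K}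
    (hf : Irreducible (f : K[X])) {a : V} (ha : IsUnit (evalAt a f)) : Irreducible f := by
  have key : ∀ g h : integerValuedPolynomials V K, f = g * h → IsUnit (g : K[X]) → IsUnit g := by
    intro g h hgh hg
    obtain ⟨c, hc⟩ := natDegree_eq_zero.1 (natDegree_eq_zero_of_isUnit hg)
    have h1 : algebraMap V K (evalAt a g) = c := by rw [algebraMap_evalAt, ← hc, eval_C]
    have h2 : g = const K (evalAt a g) := by
      ext1
      rw [coe_const, h1, hc]
    rw [hgh, map_mul] at ha
    rw [h2]
    exact (isUnit_of_mul_isUnit_left ha).map _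
  refine ⟨fun h => hf.not_isUnit (h.map (integerValuedPolynomials V K).subtype), fun {g h} hgh => ?_⟩
  rcases hf.isUnit_or_isUnit (congrArg Subtype.val hgh) with h1 | h1
  · exact Or.inl (key g h hgh h1)
  · exact Or.inr (key h g (by rw [hgh, mul_comm]) h1)

end integerValuedPolynomials

/-! ### Residue systems modulo powers of the maximal ideal -/

section Interpolation

open integerValuedPolynomials

variable {V : Type*} [CommRing V] [IsDomain V] [IsDiscreteValuationRing V]

/-- The valuation of `x` is less than `M`, that of `y` at least `M`. -/
theorem exists_eq_mul_of_not_mem_pow {M : ℕ} {x y : V}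
    (hx : x ∉ IsLocalRing.maximalIdeal V ^ M) (hy : y ∈ IsLocalRing.maximalIdeal V ^ M) :
    ∃ μ ∈ IsLocalRing.maximalIdeal V, y = x * μ := by
  obtain ⟨ϖ, hϖ⟩ := IsDiscreteValuationRing.exists_irreducible V
  have hx0 : x ≠ 0 := by
    rintro rfl
    exact hx (zero_mem _)
  obtain ⟨j, hj⟩ := IsDiscreteValuationRing.associated_pow_irreducible hx0 hϖ
  rw [hϖ.maximalIdeal_eq, Ideal.span_singleton_pow, Ideal.mem_span_singleton] at hx hy
  have hjM : j < M := by
    by_contra! h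
    exact hx ((pow_dvd_pow ϖ h).trans hj.symm.dvd)
  obtain ⟨u, hu⟩ := hj
  obtain ⟨c, rfl⟩ := hy
  obtain ⟨i, rfl⟩ := Nat.exists_eq_add_of_lt hjM
  refine ⟨u * ϖ ^ (i + 1) * c, ?_, ?_⟩
  · rw [hϖ.maximalIdeal_eq, Ideal.mem_span_singleton]
    exact ((dvd_pow_self ϖ (Nat.succ_ne_zero i)).mul_left _).mul_right _
  · rw [← mul_assoc, ← mul_assoc, hu]
    ring

theorem exists_eq_mul_of_sub_mem_pow {M : ℕ} {x y : V}
    (hx : x ∉ IsLocalRing.maximalIdeal V ^ M) (hxy : y - x ∈ IsLocalRing.maximalIdeal V ^ M) :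
    ∃ u : V, u - 1 ∈ IsLocalRing.maximalIdeal V ∧ y = x * u := by
  obtain ⟨μ, hμ, h⟩ := exists_eq_mul_of_not_mem_pow hx hxy
  exact ⟨1 + μ, by simpa using hμ, by linear_combination h⟩

theorem isUnit_of_sub_one_mem_maximalIdeal {u : V} (hu : u - 1 ∈ IsLocalRing.maximalIdeal V) :
    IsUnit u := by
  by_contra h
  have h1 : u ∈ IsLocalRing.maximalIdeal V := h
  refine (Ideal.ne_top_iff_one _).1 (IsLocalRing.maximalIdeal.isMaximal V).ne_top ?_
  simpa using sub_mem h1 hu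

variable (M : ℕ)

theorem out_sub_out_not_mem {s t : V ⧸ IsLocalRing.maximalIdeal V ^ M} (h : s ≠ t) :
    s.out - t.out ∉ IsLocalRing.maximalIdeal V ^ M := by
  rw [← Ideal.Quotient.eq, Ideal.Quotient.mk_out, Ideal.Quotient.mk_out]
  exact h

variable [Fintype (V ⧸ IsLocalRing.maximalIdeal V ^ M)]
  [DecidableEq (V ⧸ IsLocalRing.maximalIdeal V ^ M)]

/-- A complete system of residues modulo a power of the maximal ideal is balanced: the valuation
of the product of the differences from a given element is the same for all elements. -/
theorem associated_prod_erase_out_sub_out (s t : V ⧸ IsLocalRing.maximalIdeal V ^ M) :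
    Associated (∏ r ∈ Finset.univ.erase s, (s.out - r.out))
      (∏ r ∈ Finset.univ.erase t, (t.out - r.out)) := by
  -- Compare with the class `0` by the reindexing `r ↦ t - r`: `t.out - r.out` and `(t - r).out` are
  -- congruent and nonzero modulo the `M`-th power, hence associated.
  suffices h : ∀ t : V ⧸ IsLocalRing.maximalIdeal V ^ M,
      Associated (∏ r ∈ Finset.univ.erase t, (t.out - r.out))
        (∏ r ∈ Finset.univ.erase (0 : V ⧸ IsLocalRing.maximalIdeal V ^ M), r.out) from
    (h s).trans (h t).symm
  intro t
  have h1 : ∏ r ∈ Finset.univ.erase (0 : V ⧸ IsLocalRing.maximalIdeal V ^ M), r.out =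
      ∏ r ∈ Finset.univ.erase t, (t - r).out := by
    refine (Finset.prod_bij' (fun r _ => t - r) (fun r _ => t - r) ?_ ?_ ?_ ?_ ?_).symm
    · intro r hr
      simpa [sub_eq_zero, eq_comm] using hr
    · intro r hr
      simpa using hr
    · simp
    · simp
    · simp
  rw [h1]
  refine Associated.prod _ _ _ fun r hr => ?_
  obtain ⟨u, hu, h⟩ := exists_eq_mul_of_sub_mem_pow (y := (t - r).out)
    (out_sub_out_not_mem M (Finset.ne_of_mem_erase hr).symm) (by
      rw [← Ideal.Quotient.eq]
      simp)
  rw [h]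
  exact (associated_mul_unit_right _ _ (isUnit_of_sub_one_mem_maximalIdeal hu))

/-- This makes the Lagrange basis polynomial of `t` integer-valued and an indicator modulo the
maximal ideal. If `a` lies in the class `t`, each factor changes only by a unit congruent to `1`. If
`a` lies in another class `s`, compare with the product for `s`, which is associated to that for
`t`: the factor `s.out - t.out` is replaced by `a - s.out`, of larger valuation. -/
theorem exists_prod_erase_sub_out_eq (t : V ⧸ IsLocalRing.maximalIdeal V ^ M) (a : V) :
    ∃ ν : V, ∏ r ∈ Finset.univ.erase t, (a - r.out) =
        (∏ r ∈ Finset.univ.erase t, (t.out - r.out)) * ν ∧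
      ν - (if Ideal.Quotient.mk _ a = t then 1 else 0) ∈ IsLocalRing.maximalIdeal V := by
  have hu : ∀ r : V ⧸ IsLocalRing.maximalIdeal V ^ M, ∃ u : V, r ≠ Ideal.Quotient.mk _ a →
      u - 1 ∈ IsLocalRing.maximalIdeal V ∧
        a - r.out = (Quotient.out (Ideal.Quotient.mk (IsLocalRing.maximalIdeal V ^ M) a)
          - r.out) * u := by
    intro r
    by_cases hr : r = Ideal.Quotient.mk _ a
    · exact ⟨0, fun h => absurd hr h⟩
    · obtain ⟨u, hu⟩ := exists_eq_mul_of_sub_mem_pow (y := a - r.out)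
        (out_sub_out_not_mem M (Ne.symm hr)) (by
          rw [← Ideal.Quotient.eq]
          simp)
      exact ⟨u, fun _ => hu⟩
  choose u hu using hu
  split_ifs with h
  · subst h
    refine ⟨∏ r ∈ Finset.univ.erase (Ideal.Quotient.mk _ a), u r, ?_, ?_⟩
    · rw [← Finset.prod_mul_distrib]
      exact Finset.prod_congr rfl fun r hr => (hu r (Finset.ne_of_mem_erase hr)).2
    · rw [← Ideal.Quotient.eq, map_prod, map_one]
      refine Finset.prod_eq_one fun r hr => ?_
      rw [← map_one (Ideal.Quotient.mk _), Ideal.Quotient.eq]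
      exact (hu r (Finset.ne_of_mem_erase hr)).1
  · set s := Ideal.Quotient.mk (IsLocalRing.maximalIdeal V ^ M) a with hs
    obtain ⟨v, hv⟩ := associated_prod_erase_out_sub_out M t s
    obtain ⟨μ, hμ, h1⟩ := exists_eq_mul_of_not_mem_pow (y := a - s.out)
      (out_sub_out_not_mem M h) (by
        rw [← Ideal.Quotient.eq]
        simp [hs])
    refine ⟨v * μ * ∏ r ∈ (Finset.univ.erase t).erase s, u r, ?_, ?_⟩
    · rw [← mul_assoc, ← mul_assoc, hv]
      rw [← Finset.mul_prod_erase (Finset.univ.erase t) _ (Finset.mem_erase.2 ⟨h, Finset.mem_univ s⟩),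
        ← Finset.mul_prod_erase (Finset.univ.erase s) _
          (Finset.mem_erase.2 ⟨Ne.symm h, Finset.mem_univ t⟩), Finset.erase_right_comm (a := s), h1,
        Finset.prod_congr rfl fun r hr => (hu r (Finset.ne_of_mem_erase hr)).2,
        Finset.prod_mul_distrib]
      ring
    · rw [sub_zero]
      exact Ideal.mul_mem_right _ _ (Ideal.mul_mem_left _ _ hμ)

end Interpolation

/-! ### Interpolation and the family of irreducible polynomials -/

section Interpolation

open integerValuedPolynomials

variable {V : Type*} (K : Type*) [CommRing V] [IsDomain V] [IsDiscreteValuationRing V]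
  [Finite (IsLocalRing.ResidueField V)] [Field K] [Algebra V K] [IsFractionRing V K]

theorem finite_quotient_maximalIdeal_pow (M : ℕ) : Finite (V ⧸ IsLocalRing.maximalIdeal V ^ M) :=
  have : Finite (V ⧸ IsLocalRing.maximalIdeal V) :=
    inferInstanceAs (Finite (IsLocalRing.ResidueField V))
  Ideal.finite_quotient_pow (IsNoetherian.noetherian _) M

theorem exists_evalAt_eq_ite (M : ℕ) [DecidableEq (V ⧸ IsLocalRing.maximalIdeal V ^ M)]
    (t : V ⧸ IsLocalRing.maximalIdeal V ^ M) :
    ∃ P : integerValuedPolynomials V K,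
      (∀ a, evalAt a P - (if Ideal.Quotient.mk _ a = t then 1 else 0)
        ∈ IsLocalRing.maximalIdeal V) ∧
      ∀ s : V ⧸ IsLocalRing.maximalIdeal V ^ M, evalAt s.out P = if s = t then 1 else 0 := by
  have := finite_quotient_maximalIdeal_pow (V := V) M
  have := Fintype.ofFinite (V ⧸ IsLocalRing.maximalIdeal V ^ M)
  set D : V := ∏ r ∈ Finset.univ.erase t, (t.out - r.out) with hD
  have hD0 : D ≠ 0 := by
    refine Finset.prod_ne_zero_iff.2 fun r hr h => ?_
    refine out_sub_out_not_mem M (Finset.ne_of_mem_erase hr).symm ?_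
    rw [h]
    exact zero_mem _
  have hDK : algebraMap V K D ≠ 0 := by simpa using hD0
  have heval : ∀ a ν : V, ∏ r ∈ Finset.univ.erase t, (a - r.out) = D * ν →
      algebraMap V K ν = (C (algebraMap V K D)⁻¹ * ∏ r ∈ Finset.univ.erase t,
        (X - C (algebraMap V K r.out))).eval (algebraMap V K a) := by
    intro a ν h
    simp only [eval_mul, eval_C, eval_prod, eval_sub, eval_X, ← map_sub, ← map_prod]
    rw [h, map_mul, inv_mul_cancel_left₀ hDK]
  choose ν hν hνm using exists_prod_erase_sub_out_eq M t
  refine ⟨⟨C (algebraMap V K D)⁻¹ * ∏ r ∈ Finset.univ.erase t, (X - C (algebraMap V K r.out)),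
    fun a => ⟨_, heval a _ (hν a)⟩⟩, fun a => ?_, fun s => ?_⟩
  · rw [evalAt_eq_of_algebraMap_eq (heval a _ (hν a))]
    exact hνm a
  · refine evalAt_eq_of_algebraMap_eq (heval _ _ ?_)
    split_ifs with h
    · rw [h, mul_one]
    · rw [mul_zero]
      exact Finset.prod_eq_zero (Finset.mem_erase.2 ⟨h, Finset.mem_univ s⟩) (sub_self _)

/-- Interpolation by integer-valued polynomials: every function on the residue classes modulo a
power of the maximal ideal is induced modulo the maximal ideal by an integer-valued polynomial
that takes the prescribed values exactly on a system of representatives. -/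
theorem exists_evalAt_sub_mem (M : ℕ) (φ : V ⧸ IsLocalRing.maximalIdeal V ^ M → V) :
    ∃ P : integerValuedPolynomials V K,
      (∀ a, evalAt a P - φ (Ideal.Quotient.mk _ a) ∈ IsLocalRing.maximalIdeal V) ∧
      ∀ s, evalAt s.out P = φ s := by
  classical
  have := finite_quotient_maximalIdeal_pow (V := V) M
  have := Fintype.ofFinite (V ⧸ IsLocalRing.maximalIdeal V ^ M)
  choose L hL hLout using exists_evalAt_eq_ite (V := V) K M
  refine ⟨∑ t, const K (φ t) * L t, fun a => ?_, fun s => ?_⟩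
  · rw [← Ideal.Quotient.eq, map_sum, map_sum]
    have h : ∀ t, Ideal.Quotient.mk (IsLocalRing.maximalIdeal V) (evalAt a (const K (φ t) * L t)) =
        if Ideal.Quotient.mk _ a = t then Ideal.Quotient.mk _ (φ t) else 0 := by
      intro t
      rw [map_mul, map_mul, evalAt_const, Ideal.Quotient.eq.2 (hL t a)]
      split_ifs <;> simp
    rw [Finset.sum_congr rfl fun t _ => h t, Finset.sum_ite_eq, if_pos (Finset.mem_univ _)]
  · simp [hLout]

/-- The powers `ϖ ^ i` with `i < N` are pairwise incongruent. -/
theorem le_natCard_quotient_maximalIdeal_pow (N : ℕ) :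
    N ≤ Nat.card (V ⧸ IsLocalRing.maximalIdeal V ^ N) := by
  have := finite_quotient_maximalIdeal_pow (V := V) N
  obtain ⟨ϖ, hϖ⟩ := IsDiscreteValuationRing.exists_irreducible V
  have hinj : Function.Injective
      (fun i : Fin N => Ideal.Quotient.mk (IsLocalRing.maximalIdeal V ^ N) (ϖ ^ (i : ℕ))) := by
    have key : ∀ i j : Fin N, i < j →
        Ideal.Quotient.mk (IsLocalRing.maximalIdeal V ^ N) (ϖ ^ (i : ℕ)) ≠
          Ideal.Quotient.mk (IsLocalRing.maximalIdeal V ^ N) (ϖ ^ (j : ℕ)) := by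
      intro i j hij h
      rw [Ideal.Quotient.eq, hϖ.maximalIdeal_eq, Ideal.span_singleton_pow,
        Ideal.mem_span_singleton] at h
      have h1 : ϖ ^ ((i : ℕ) + 1) ∣ ϖ ^ (i : ℕ) :=
        (dvd_iff_dvd_of_dvd_sub ((pow_dvd_pow ϖ i.2).trans h)).2 (pow_dvd_pow ϖ hij)
      rw [pow_dvd_pow_iff hϖ.ne_zero hϖ.not_isUnit] at h1
      omega
    intro i j h
    rcases lt_trichotomy i j with hij | hij | hij
    · exact absurd h (key i j hij)
    · exact hij
    · exact absurd h.symm (key j i hij)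
  simpa using Nat.card_le_card_of_injective _ hinj

/-- Finitely many integer-valued polynomials with distinct degrees, irreducible over the quotient
field, whose zero sets modulo the maximal ideal have a prescribed incidence pattern. -/
theorem exists_irreducible_family {ι α : Type*} [Finite ι] [Finite α] [Nonempty α]
    {W : ValuationSubring K} (hW : IsIndependentFrom V W)
    (h : ((IsLocalRing.maximalIdeal W).IsPrincipal ∧ IsLocalRing.maximalIdeal W ≠ ⊥) ∨
        Finite (IsLocalRing.ResidueField W)) (Z : ι → α → Prop) :
    ∃ f : ι → integerValuedPolynomials V K, (∀ i, Irreducible (f i : K[X])) ∧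
      Function.Injective (fun i => (f i : K[X]).natDegree) ∧
      ∃ c : V → α, (∀ i a, evalAt a (f i) ∈ IsLocalRing.maximalIdeal V ↔ Z i (c a)) ∧
        ∀ p, ∃ a, c a = p ∧ ∀ i, evalAt a (f i) ∉ IsLocalRing.maximalIdeal V ^ 2 := by
  classical
  have := Fintype.ofFinite ι
  have := Fintype.ofFinite α
  set M := Fintype.card α
  have := finite_quotient_maximalIdeal_pow (V := V) M
  have := Fintype.ofFinite (V ⧸ IsLocalRing.maximalIdeal V ^ M)
  obtain ⟨ϖ, hϖ⟩ := IsDiscreteValuationRing.exists_irreducible V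
  have hϖm : ϖ ∈ IsLocalRing.maximalIdeal V := hϖ.not_isUnit
  have hϖ2 : ϖ ∉ IsLocalRing.maximalIdeal V ^ 2 := by
    rw [hϖ.maximalIdeal_eq, Ideal.span_singleton_pow, Ideal.mem_span_singleton]
    intro h1
    have := (pow_dvd_pow_iff hϖ.ne_zero hϖ.not_isUnit (n := 2) (m := 1)).1 (by simpa using h1)
    omega
  have h1m : (1 : V) ∉ IsLocalRing.maximalIdeal V :=
    (Ideal.ne_top_iff_one _).1 (IsLocalRing.maximalIdeal.isMaximal V).ne_top
  have hle : IsLocalRing.maximalIdeal V ^ 2 ≤ IsLocalRing.maximalIdeal V :=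
    Ideal.pow_le_self two_ne_zero
  obtain ⟨c, hc⟩ : ∃ c : V ⧸ IsLocalRing.maximalIdeal V ^ M → α, Function.Surjective c := by
    obtain ⟨e⟩ := Function.Embedding.nonempty_of_card_le (α := α)
      (β := V ⧸ IsLocalRing.maximalIdeal V ^ M) (by
        rw [← Nat.card_eq_fintype_card (α := V ⧸ _)]
        exact le_natCard_quotient_maximalIdeal_pow M)
    exact ⟨Function.invFun e, Function.invFun_surjective e.injective⟩
  -- The values `ϖ` and `1` encode the pattern and avoid the square of the maximal ideal at the
  -- representatives.
  choose P hP hPout using fun i => exists_evalAt_sub_mem K M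
    (fun t => if Z i (c t) then ϖ else 1)
  -- These target degrees exceed every `natDegree` of the `P i` and are made distinct by the
  -- enumeration of `ι`.
  have hdeg : ∀ i, (P i : K[X]).natDegree <
      (∑ j, (P j : K[X]).natDegree) + 1 + Fintype.equivFin ι i := by
    intro i
    have := Finset.single_le_sum (f := fun j => (P j : K[X]).natDegree) (by simp)
      (Finset.mem_univ i)
    omega
  -- Perturbing by multiples of `ϖ ^ 2` keeps all values fixed modulo the square of the maximal
  -- ideal.
  choose Q hQ hQdeg D hD using fun i => exists_irreducible_sub_coeff_mem hW h
    (pow_ne_zero 2 hϖ.ne_zero) (P i : K[X]) (hdeg i)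
  have heval : ∀ i a, algebraMap V K (evalAt a (P i) + ϖ ^ 2 * (D i).eval a) =
      (Q i).eval (algebraMap V K a) := by
    intro i a
    rw [hD, eval_add, eval_mul, eval_C, eval_map_algebraMap, aeval_algebraMap_apply, map_add,
      map_mul, algebraMap_evalAt, coe_aeval_eq_eval]
  have hmem : ∀ i a, ϖ ^ 2 * (D i).eval a ∈ IsLocalRing.maximalIdeal V ^ 2 := fun i a =>
    Ideal.mul_mem_right _ _ (Ideal.pow_mem_pow hϖm 2)
  refine ⟨fun i => ⟨Q i, fun a => ⟨_, heval i a⟩⟩, hQ, ?_,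
    fun a => c (Ideal.Quotient.mk _ a), fun i a => ?_, fun p => ?_⟩
  · intro i j hij
    have hij : (Q i).natDegree = (Q j).natDegree := hij
    rw [hQdeg, hQdeg] at hij
    exact (Fintype.equivFin ι).injective (Fin.ext (by omega))
  · rw [evalAt_eq_of_algebraMap_eq (heval i a), Ideal.add_mem_iff_left _ (hle (hmem i a)),
      ← sub_add_cancel (evalAt a (P i)) _, Ideal.add_mem_iff_right _ (hP i a)]
    split_ifs with hZ <;> simp [hZ, hϖm, h1m]
  · obtain ⟨t, rfl⟩ := hc p
    refine ⟨t.out, by simp, fun i => ?_⟩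
    rw [evalAt_eq_of_algebraMap_eq (heval i _), Ideal.add_mem_iff_left _ (hmem i _), hPout]
    split_ifs
    · exact hϖ2
    · exact fun h1 => h1m (hle h1)

end Interpolation

/-! ### Factorizations of a product divided by a uniformizer -/

namespace integerValuedPolynomials

variable {V K : Type*} [CommRing V] [IsDomain V] [IsDiscreteValuationRing V]
  [Field K] [Algebra V K] [IsFractionRing V K]

/-- If a product of polynomials that are irreducible over the quotient field, divided by a
uniformizer, is factored in the ring of integer-valued polynomials, then the factors are, up to
units and the uniformizer, subproducts. -/
theorem exists_fiberwise_eq {ι : Type*} [DecidableEq ι]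
    {f : ι → integerValuedPolynomials V K} (hf : ∀ i, Irreducible (f i : K[X]))
    (hdeg : Function.Injective (fun i => (f i : K[X]).natDegree)) {i₀ : ι} {a : V}
    (ha : ∀ i ≠ i₀, IsUnit (evalAt a (f i)))
    (ha₀ : evalAt a (f i₀) ∉ IsLocalRing.maximalIdeal V ^ 2) {ϖ : V} (hϖ : Irreducible ϖ)
    {S : Finset ι} (hS : i₀ ∈ S) {n : ℕ} {g : Fin n → integerValuedPolynomials V K}
    (hg : const K ϖ * ∏ j, g j = ∏ i ∈ S, f i) :
    ∃ σ : ι → Fin n, ∃ γ : Fin n → Vˣ,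
      (∀ j ≠ σ i₀, g j = const K (γ j : V) * ∏ i ∈ S with σ i = j, f i) ∧
      const K ϖ * g (σ i₀) = const K (γ (σ i₀) : V) * ∏ i ∈ S with σ i = σ i₀, f i := by
  have hϖK : algebraMap V K ϖ ≠ 0 := by simpa using hϖ.ne_zero
  have hgK : C (algebraMap V K ϖ) * ∏ j, (g j : K[X]) = ∏ i ∈ S, (f i : K[X]) := by
    have := congrArg (integerValuedPolynomials V K).subtype hg
    simpa [map_prod] using this
  have hσ : ∀ i, ∃ j, i ∈ S → (f i : K[X]) ∣ g j := by
    have hσS : ∀ i ∈ S, ∃ j, (f i : K[X]) ∣ g j := by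
      intro i hi
      have h1 : (f i : K[X]) ∣ ∏ j, (g j : K[X]) := by
        have h2 := Finset.dvd_prod_of_mem (fun i => (f i : K[X])) hi
        rw [← hgK] at h2
        exact (isUnit_C.2 hϖK.isUnit).dvd_mul_left.1 h2
      obtain ⟨j, -, hj⟩ := (hf i).prime.exists_mem_finset_dvd h1
      exact ⟨j, hj⟩
    intro i
    by_cases hi : i ∈ S
    · obtain ⟨j, hj⟩ := hσS i hi
      exact ⟨j, fun _ => hj⟩
    · obtain ⟨j, -⟩ := hσS i₀ hS
      exact ⟨j, fun h => absurd h hi⟩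
  choose σ hσ using hσ
  -- Irreducibles of distinct degrees are coprime, so each `g j` is divisible by its whole fibre;
  -- the cofactors `r j` turn out to be constants.
  have hF : ∀ j, ∏ i ∈ S with σ i = j, (f i : K[X]) ∣ g j := by
    intro j
    refine Finset.prod_dvd_of_coprime (fun i _ l _ hil => ?_) fun i hi => ?_
    · refine (hf i).coprime_iff_not_dvd.2 fun hdvd => hil (hdeg ?_)
      exact natDegree_eq_of_degree_eq
        (degree_eq_degree_of_associated ((hf i).associated_of_dvd (hf l) hdvd))
    · rw [Finset.mem_filter] at hi
      exact hi.2 ▸ hσ i hi.1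
  choose r hr using hF
  have hS0 : ∏ i ∈ S, (f i : K[X]) ≠ 0 := Finset.prod_ne_zero_iff.2 fun i _ => (hf i).ne_zero
  have hr1 : C (algebraMap V K ϖ) * ∏ j, r j = 1 := by
    refine mul_left_cancel₀ hS0 ?_
    rw [mul_one]
    conv_rhs => rw [← hgK, Finset.prod_congr rfl fun j _ => hr j, Finset.prod_mul_distrib,
      Finset.prod_fiberwise]
    ring
  have hrC : ∀ j, ∃ c : K, C c = r j := by
    intro j
    have h1 : IsUnit (r j) := isUnit_of_dvd_one
      (((Finset.dvd_prod_of_mem r (Finset.mem_univ j)).mul_left _).trans hr1.dvd)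
    exact natDegree_eq_zero.1 (natDegree_eq_zero_of_isUnit h1)
  choose c hc using hrC
  have hc1 : algebraMap V K ϖ * ∏ j, c j = 1 := by
    apply C_injective (R := K)
    rw [C_mul, map_prod, C_1, ← hr1]
    simp only [hc]
  have heval : ∀ j, algebraMap V K (evalAt a (g j)) =
      algebraMap V K (∏ i ∈ S with σ i = j, evalAt a (f i)) * c j := by
    intro j
    rw [algebraMap_evalAt, hr, eval_mul, ← hc, eval_C, eval_prod, map_prod]
    simp only [algebraMap_evalAt]
  -- Evaluate at `a`: the fibre product is a unit there, except that over `σ i₀` it may have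
  -- valuation one. So `c j`, or `ϖ * c j` over `σ i₀`, lies in `V`. The product of these elements
  -- is `1`, hence all are units.
  have hγ : ∀ j, ∃ γ : V, algebraMap V K γ = (if j = σ i₀ then algebraMap V K ϖ else 1) * c j := by
    intro j
    split_ifs with hj
    · obtain ⟨e, he⟩ : ∏ i ∈ S with σ i = j, evalAt a (f i) ∣ ϖ := by
        rw [← Finset.mul_prod_erase _ _ (Finset.mem_filter.2 ⟨hS, hj.symm⟩)]
        have hu : IsUnit (∏ i ∈ ({i ∈ S | σ i = j}).erase i₀, evalAt a (f i)) :=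
          Finset.prod_induction _ IsUnit (fun _ _ => IsUnit.mul) isUnit_one fun i hi =>
            ha i (Finset.ne_of_mem_erase hi)
        rw [hu.mul_right_dvd]
        by_cases h1 : evalAt a (f i₀) ∈ IsLocalRing.maximalIdeal V
        · obtain ⟨e, he⟩ : ϖ ∣ evalAt a (f i₀) := by
            rwa [hϖ.maximalIdeal_eq, Ideal.mem_span_singleton] at h1
          have he' : IsUnit e := by
            by_contra h2
            apply ha₀
            rw [he, pow_two]
            exact Ideal.mul_mem_mul hϖ.not_isUnit h2
          rw [he, he'.mul_right_dvd]
        · exact (not_not.1 h1 : IsUnit _).dvd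
      refine ⟨evalAt a (g j) * e, ?_⟩
      rw [map_mul, heval, he, map_mul]
      ring
    · have hu : IsUnit (∏ i ∈ S with σ i = j, evalAt a (f i)) :=
        Finset.prod_induction _ IsUnit (fun _ _ => IsUnit.mul) isUnit_one fun i hi =>
          ha i (by
            rintro rfl
            exact hj (Finset.mem_filter.1 hi).2.symm)
      obtain ⟨e, he⟩ := hu.exists_left_inv
      refine ⟨e * evalAt a (g j), ?_⟩
      rw [map_mul, heval, ← mul_assoc, ← map_mul, he, map_one]
  choose γ hγ using hγ
  have hγ1 : ∏ j, γ j = 1 := by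
    apply IsFractionRing.injective V K
    rw [map_prod, map_one, ← hc1]
    simp only [hγ]
    rw [Finset.prod_mul_distrib, Finset.prod_ite_eq' , if_pos (Finset.mem_univ _)]
  have hγu : ∀ j, IsUnit (γ j) := fun j =>
    isUnit_of_dvd_one ((Finset.dvd_prod_of_mem γ (Finset.mem_univ j)).trans hγ1.dvd)
  choose u hu using hγu
  refine ⟨σ, u, fun j hj => ?_, ?_⟩
  · ext1
    rw [hr, Subring.coe_mul, coe_const, hu, hγ, if_neg hj, one_mul, hc, mul_comm]
    simp
  · ext1
    rw [Subring.coe_mul, Subring.coe_mul, coe_const, coe_const, hr, hu, hγ, if_pos rfl, C_mul, hc]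
    push_cast
    ring

/-- The same for a product with a distinguished factor `f₀`. -/
theorem exists_fiberwise_eq' {J : Type*} [DecidableEq J]
    {f₀ : integerValuedPolynomials V K} {f : J → integerValuedPolynomials V K}
    (hf₀ : Irreducible (f₀ : K[X])) (hf : ∀ x, Irreducible (f x : K[X]))
    (hdeg₀ : ∀ x, (f x : K[X]).natDegree ≠ (f₀ : K[X]).natDegree)
    (hdeg : Function.Injective (fun x => (f x : K[X]).natDegree)) {a : V}
    (ha : ∀ x, IsUnit (evalAt a (f x)))
    (ha₀ : evalAt a f₀ ∉ IsLocalRing.maximalIdeal V ^ 2) {ϖ : V} (hϖ : Irreducible ϖ)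
    {A : Finset J} {n : ℕ} {g : Fin n → integerValuedPolynomials V K}
    (hg : const K ϖ * ∏ j, g j = f₀ * ∏ x ∈ A, f x) :
    ∃ j₀ : Fin n, ∃ σ : J → Fin n, ∃ γ : Fin n → Vˣ,
      (∀ j ≠ j₀, g j = const K (γ j : V) * ∏ x ∈ A with σ x = j, f x) ∧
      const K ϖ * g j₀ = const K (γ j₀ : V) * (f₀ * ∏ x ∈ A with σ x = j₀, f x) := by
  obtain ⟨σ, γ, h1, h2⟩ := exists_fiberwise_eq (f := fun o : Option J => o.elim f₀ f)
    (i₀ := none) (a := a) (S := Finset.insertNone A) (ϖ := ϖ) (g := g)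
    (by rintro (_ | x) <;> simp [hf₀, hf])
    (by
      rintro (_ | x) (_ | y) h
      · rfl
      · exact absurd h.symm (hdeg₀ y)
      · exact absurd h (hdeg₀ x)
      · exact congrArg some (hdeg h))
    (by
      rintro (_ | x) h
      · exact absurd rfl h
      · exact ha x)
    ha₀ hϖ (by simp) (by rw [hg, Finset.prod_insertNone]; rfl)
  refine ⟨σ none, fun x => σ (some x), γ, fun j hj => ?_, ?_⟩
  · rw [h1 j hj]
    congr 1
    rw [Finset.prod_filter, Finset.prod_filter, Finset.prod_insertNone, if_neg (Ne.symm hj),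
      one_mul]
    rfl
  · rw [h2]
    congr 1
    rw [Finset.prod_filter, Finset.prod_filter, Finset.prod_insertNone, if_pos rfl]
    rfl

/-- A product divided by a uniformizer whose subproducts are divisible by the uniformizer if and
only if the omitted factors lie in a single block has exactly one factorization for every
block. -/
theorem exists_factorizations_of_blocks {J B : Type*} [Fintype J] [Nonempty B]
    [DecidableEq J] [DecidableEq B] {β : J → B} (hβ : Function.Surjective β)
    {f₀ : integerValuedPolynomials V K} {f : J → integerValuedPolynomials V K}
    (hf₀ : Irreducible (f₀ : K[X])) (hf : ∀ x, Irreducible (f x : K[X]))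
    (hdeg₀ : ∀ x, (f x : K[X]).natDegree ≠ (f₀ : K[X]).natDegree)
    (hdeg : Function.Injective (fun x => (f x : K[X]).natDegree)) {a : V}
    (ha : ∀ x, IsUnit (evalAt a (f x)))
    (ha₀ : evalAt a f₀ ∉ IsLocalRing.maximalIdeal V ^ 2) {ϖ : V} (hϖ : Irreducible ϖ)
    (hcov : ∀ A : Finset J, const K ϖ ∣ f₀ * ∏ x ∈ A, f x ↔
      ∀ x ∉ A, ∀ y ∉ A, β x = β y) :
    ∃ (H : integerValuedPolynomials V K) (φ : B → Multiset (integerValuedPolynomials V K)),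
      (∀ b, IsFactorization H (φ b) ∧ Multiset.card (φ b) = Fintype.card {x // β x = b} + 1) ∧
      (∀ b b', b ≠ b' → ¬ EssentiallySame (φ b) (φ b')) ∧
      ∀ s, IsFactorization H s → ∃ b, EssentiallySame s (φ b) := by
  have hϖ0 : const K ϖ ≠ 0 := const_ne_zero hϖ.ne_zero
  have hirr : ∀ x, Irreducible (f x) := fun x => irreducible_of_isUnit_evalAt (hf x) (ha x)
  obtain ⟨H, hH⟩ := (hcov Finset.univ).2 (by simp)
  have hG : ∀ b, ∃ G, f₀ * ∏ x with β x ≠ b, f x = const K ϖ * G := by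
    intro b
    refine (hcov _).2 fun x hx y hy => ?_
    simp only [Finset.mem_filter, Finset.mem_univ, true_and, not_not] at hx hy
    rw [hx, hy]
  choose G hG using hG
  have hunit : ∀ u : Vˣ, IsUnit (const K (u : V)) := fun u => u.isUnit.map _
  have hGirr : ∀ b, Irreducible (G b) := by
    intro b
    refine ⟨fun h => ?_, fun {g h} hgh => ?_⟩
    · have h1 : IsUnit (const K ϖ * G b : integerValuedPolynomials V K).1 := by
        rw [Subring.coe_mul]
        refine IsUnit.mul ?_ (h.map (integerValuedPolynomials V K).subtype)
        rw [coe_const, isUnit_C]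
        exact (by simpa using hϖ.ne_zero : algebraMap V K ϖ ≠ 0).isUnit
      rw [← hG b, Subring.coe_mul] at h1
      exact hf₀.not_isUnit (isUnit_of_mul_isUnit_left h1)
    · obtain ⟨j₀, σ, γ, h1, h2⟩ := exists_fiberwise_eq' hf₀ hf hdeg₀ hdeg ha ha₀ hϖ
        (A := {x | β x ≠ b}) (g := ![g, h]) (by
          rw [hG b, hgh]
          simp)
      have h3 : const K ϖ ∣ f₀ * ∏ x ∈ {x | β x ≠ b} with σ x = j₀, f x :=
        (hunit (γ j₀)).dvd_mul_left.1 (Dvd.intro _ h2)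
      obtain ⟨z, hz⟩ := hβ b
      -- The factor with `f₀` omits some `z` of block `b`, so it can omit nothing outside `b`; the
      -- other factor is then a unit.
      have h4 : ∀ x, β x ≠ b → σ x = j₀ := by
        intro x hx
        by_contra hxσ
        apply hx
        rw [← hz]
        exact (hcov _).1 h3 x (by simp [hxσ]) z (by simp [hz])
      have h5 : ∀ j ≠ j₀, IsUnit (![g, h] j) := by
        intro j hj
        rw [h1 j hj, Finset.filter_false_of_mem, Finset.prod_empty, mul_one]
        · exact hunit _
        · intro x hx
          rw [h4 x (by simpa using hx)]
          exact hj.symm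
      rcases eq_or_ne 0 j₀ with h6 | h6
      · exact Or.inr (h5 1 (by rw [← h6]; simp))
      · exact Or.inl (h5 0 h6)
  refine ⟨H, fun b => G b ::ₘ (Finset.univ.filter (β · = b)).val.map f,
    fun b => ⟨⟨?_, ?_⟩, ?_⟩, fun b b' hbb' hsame => ?_, fun s hs => ?_⟩
  · intro p hp
    rcases Multiset.mem_cons.1 hp with rfl | hp
    · exact hGirr b
    · obtain ⟨x, -, rfl⟩ := Multiset.mem_map.1 hp
      exact hirr x
  · refine mul_left_cancel₀ hϖ0 ?_
    rw [← hH, Multiset.prod_cons, ← mul_assoc, ← hG b, mul_assoc]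
    congr 1
    rw [mul_comm]
    exact Finset.prod_filter_mul_prod_filter_not Finset.univ (β · = b) f
  · rw [Multiset.card_cons, Multiset.card_map, Finset.card_val, Fintype.card_subtype]
  · have hassoc : ∀ p q : integerValuedPolynomials V K, Associated p q →
        (p : K[X]).natDegree = (q : K[X]).natDegree := fun p q h =>
      natDegree_eq_of_degree_eq
        (degree_eq_degree_of_associated (h.map (integerValuedPolynomials V K).subtype))
    obtain ⟨x, hx⟩ := hβ b
    have hmem : f x ∈ G b ::ₘ (Finset.univ.filter (β · = b)).val.map f :=
      Multiset.mem_cons_of_mem (Multiset.mem_map_of_mem f (by simpa using hx))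
    obtain ⟨q, hq, hxq⟩ := Multiset.exists_mem_of_rel_of_mem hsame hmem
    -- `G b'` is too large in degree to be associated to `f x`, since it contains both `f₀` and `f
    -- x` up to a constant.
    rcases Multiset.mem_cons.1 hq with rfl | hq
    · have h1 := hassoc _ _ hxq
      have h2 : (const K ϖ * G b' : integerValuedPolynomials V K).1.natDegree =
          (f x : K[X]).natDegree := by
        rw [h1, Subring.coe_mul, coe_const, natDegree_C_mul (by simpa using hϖ.ne_zero)]
      have hx' : x ∈ Finset.univ.filter (β · ≠ b') := by simpa [hx] using hbb'
      have h3 : ∏ y ∈ (Finset.univ.filter (β · ≠ b')).erase x, (f y : K[X]) ≠ 0 :=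
        Finset.prod_ne_zero_iff.2 fun y _ => (hf y).ne_zero
      rw [← hG b', ← Finset.mul_prod_erase _ _ hx', Subring.coe_mul, Subring.coe_mul,
        natDegree_mul hf₀.ne_zero (mul_ne_zero (hf x).ne_zero (by push_cast; exact h3)),
        natDegree_mul (hf x).ne_zero (by push_cast; exact h3)] at h2
      have := hf₀.natDegree_pos
      omega
    · obtain ⟨y, hy, rfl⟩ := Multiset.mem_map.1 hq
      have h1 : x = y := hdeg (hassoc _ _ hxq)
      apply hbb'
      rw [← hx, h1]
      simpa using hy
  · obtain ⟨hsirr, hsprod⟩ := hs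
    obtain ⟨n, g, rfl⟩ : ∃ (n : ℕ) (g : Fin n → integerValuedPolynomials V K),
        s = Finset.univ.val.map g := by
      refine Quotient.inductionOn s fun l => ⟨l.length, l.get, ?_⟩
      simp
    have hgirr : ∀ j, Irreducible (g j) := fun j =>
      hsirr _ (Multiset.mem_map_of_mem g (Finset.mem_univ j))
    obtain ⟨j₀, σ, γ, h1, h2⟩ := exists_fiberwise_eq' hf₀ hf hdeg₀ hdeg ha ha₀ hϖ
      (A := Finset.univ) (g := g) (by
        rw [hH, ← hsprod]
        rfl)
    have h3 : const K ϖ ∣ f₀ * ∏ x with σ x = j₀, f x :=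
      (hunit (γ j₀)).dvd_mul_left.1 (Dvd.intro _ h2)
    have h4 := (hcov _).1 h3
    simp only [Finset.mem_filter, Finset.mem_univ, true_and] at h4
    obtain ⟨b, hb⟩ : ∃ b, ∀ x, σ x ≠ j₀ → β x = b := by
      by_cases h : ∃ y, σ y ≠ j₀
      · obtain ⟨y, hy⟩ := h
        exact ⟨β y, fun x hx => h4 x hx y hy⟩
      · push Not at h
        -- If nothing is omitted, any block serves here; the next step shows that it must be omitted
        -- entirely.
        exact ⟨Classical.arbitrary B, fun x hx => absurd (h x) hx⟩
    have hb' : ∀ x, σ x ≠ j₀ ↔ β x = b := by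
      refine fun x => ⟨hb x, fun hx hxσ => ?_⟩
      have hxmem : x ∈ Finset.univ.filter (σ · = j₀) := by simpa using hxσ
      -- An `f x` of block `b` remaining in `g j₀` could be split off without losing divisibility by
      -- `ϖ`, against irreducibility.
      obtain ⟨G', hG'⟩ := (hcov ((Finset.univ.filter (σ · = j₀)).erase x)).2 (by
        have h5 : ∀ y ∉ (Finset.univ.filter (σ · = j₀)).erase x, β y = b := by
          intro y hy
          by_cases hyx : y = x
          · rw [hyx, hx]
          · exact hb y (by simpa [hyx] using hy)
        intro y hy z hz
        rw [h5 y hy, h5 z hz])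
      have h6 : g j₀ = const K (γ j₀ : V) * G' * f x := by
        refine mul_left_cancel₀ hϖ0 ?_
        rw [h2, ← Finset.mul_prod_erase _ _ hxmem]
        linear_combination (const K (γ j₀ : V) * f x) * hG'
      rcases (hgirr j₀).isUnit_or_isUnit h6 with h7 | h7
      · have h8 : IsUnit G' := isUnit_of_mul_isUnit_right h7
        have h9 : IsUnit (const K ϖ * G' : integerValuedPolynomials V K).1 := by
          rw [Subring.coe_mul]
          refine IsUnit.mul ?_ (h8.map (integerValuedPolynomials V K).subtype)
          rw [coe_const, isUnit_C]
          exact (by simpa using hϖ.ne_zero : algebraMap V K ϖ ≠ 0).isUnit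
        rw [← hG', Subring.coe_mul] at h9
        exact hf₀.not_isUnit (isUnit_of_mul_isUnit_left h9)
      · exact (hirr x).not_isUnit h7
    -- Away from `j₀`, an irreducible factor is a unit times a product of irreducibles `f x`, so its
    -- fibre is a single index.
    have hfib : ∀ j ≠ j₀, ∃ x, σ x = j ∧ Associated (g j) (f x) ∧ ∀ y, σ y = j → y = x := by
      intro j hj
      have h5 : Irreducible (∏ x with σ x = j, f x) := by
        have := hgirr j
        rwa [h1 j hj, irreducible_isUnit_mul (hunit (γ j))] at this
      obtain ⟨x, hx⟩ : (Finset.univ.filter (σ · = j)).Nonempty := by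
        rw [Finset.nonempty_iff_ne_empty]
        intro h6
        rw [h6, Finset.prod_empty] at h5
        exact h5.not_isUnit isUnit_one
      have hu : IsUnit (∏ y ∈ (Finset.univ.filter (σ · = j)).erase x, f y) := by
        rw [← Finset.mul_prod_erase _ _ hx] at h5
        exact (h5.isUnit_or_isUnit rfl).resolve_left (hirr x).not_isUnit
      refine ⟨x, (Finset.mem_filter.1 hx).2, ?_, fun y hy => ?_⟩
      · rw [h1 j hj, ← Finset.mul_prod_erase _ _ hx]
        exact (associated_unit_mul_left _ _ (hunit _)).trans (associated_mul_unit_left _ _ hu)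
      · by_contra hyx
        have hy' : y ∈ (Finset.univ.filter (σ · = j)).erase x := by simp [hyx, hy]
        exact (hirr y).not_isUnit (isUnit_of_dvd_unit (Finset.dvd_prod_of_mem f hy') hu)
    refine ⟨b, ?_⟩
    have huniv : (Finset.univ : Finset (Fin n)).val =
        j₀ ::ₘ (Finset.univ.filter (β · = b)).val.map σ := by
      have hinj : Set.InjOn σ (Finset.univ.filter (β · = b)) := by
        intro x hx y hy hxy
        simp only [Finset.coe_filter, Finset.mem_univ, true_and, Set.mem_ofPred_eq, ← hb'] at hx
        obtain ⟨z, -, -, hz⟩ := hfib (σ x) hx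
        rw [hz x rfl, hz y hxy.symm]
      have himage : Finset.univ.erase j₀ = (Finset.univ.filter (β · = b)).image σ := by
        ext j
        simp only [Finset.mem_erase, Finset.mem_univ, and_true, Finset.mem_image,
          Finset.mem_filter, true_and]
        constructor
        · intro hj
          obtain ⟨x, hx, -⟩ := hfib j hj
          exact ⟨x, (hb' x).1 (by rwa [hx]), hx⟩
        · rintro ⟨x, hx, rfl⟩
          exact (hb' x).2 hx
      rw [← Finset.image_val_of_injOn hinj, ← himage, Finset.erase_val,
        Multiset.cons_erase (Finset.mem_univ j₀)]
    change Multiset.Rel Associated (Multiset.map g Finset.univ.val) _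
    rw [huniv, Multiset.map_cons, Multiset.map_map]
    refine Multiset.Rel.cons ?_ ?_
    · have h5 : const K ϖ * g j₀ = const K ϖ * (const K (γ j₀ : V) * G b) := by
        rw [h2, mul_left_comm (const K ϖ), ← hG b]
        congr 3
        ext x
        simp [← hb']
      rw [mul_left_cancel₀ hϖ0 h5]
      exact associated_unit_mul_left _ _ (hunit _)
    · rw [Multiset.rel_map]
      refine Multiset.rel_refl_of_refl_on fun x hx => ?_
      have hx' : β x = b := by simpa using hx
      obtain ⟨z, -, hz, hz'⟩ := hfib (σ x) ((hb' x).2 hx')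
      rw [hz' x rfl]
      rw [← hz' x rfl] at hz ⊢
      exact hz

end integerValuedPolynomials

/-! ### The incidence pattern for the prescribed lengths -/

open integerValuedPolynomials in
theorem mainTheorem1
    {V K : Type*} [CommRing V] [IsDomain V] [IsDiscreteValuationRing V]
    [Finite (IsLocalRing.ResidueField V)]
    [Field K] [Algebra V K] [IsFractionRing V K]
    (hW : ∃ W : ValuationSubring K, IsIndependentFrom V W ∧
      (((IsLocalRing.maximalIdeal W).IsPrincipal ∧ IsLocalRing.maximalIdeal W ≠ ⊥) ∨
        Finite (IsLocalRing.ResidueField W)))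
    (k : ℕ) (hk : 0 < k) (n : Fin k → ℕ) (hn : ∀ i, 1 < n i) (hmono : Monotone n) :
    ∃ (H : integerValuedPolynomials V K)
      (φ : Fin k → Multiset (integerValuedPolynomials V K)),
      (∀ i, IsFactorization H (φ i) ∧ Multiset.card (φ i) = n i) ∧
      (∀ i j, i ≠ j → ¬ EssentiallySame (φ i) (φ j)) ∧
      (∀ s : Multiset (integerValuedPolynomials V K), IsFactorization H s →
        ∃ i, EssentiallySame s (φ i)) := by
  obtain ⟨W, hVW, hW⟩ := hW
  have : Nonempty (Fin k) := ⟨⟨0, hk⟩⟩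
  obtain ⟨ϖ, hϖ⟩ := IsDiscreteValuationRing.exists_irreducible V
  -- Block `i` has `n i - 1` elements because the factor containing `f₀` contributes one more; it is
  -- nonempty since `1 < n i`.
  let J := Σ i : Fin k, Fin (n i - 1)
  -- A point `some (x, y)` with `x`, `y` in different blocks is a common zero of `f x` and `f y`
  -- only; all other points are zeros of the distinguished polynomial only.
  let Z : Option J → Option (J × J) → Prop := fun o p =>
    p.elim (o = none) fun q => if q.1.1 = q.2.1 then o = none else o = some q.1 ∨ o = some q.2
  obtain ⟨f, hf, hdeg, c, hc, hval⟩ := exists_irreducible_family K hVW hW Z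
  -- At this point only `f none` vanishes modulo the maximal ideal, and only to first order; it ties
  -- the denominator `ϖ` to `f none`.
  obtain ⟨a, hca, ha⟩ := hval none
  have hprime : (IsLocalRing.maximalIdeal V).IsPrime := inferInstance
  have hdvd : ∀ b : V, ϖ ∣ b ↔ b ∈ IsLocalRing.maximalIdeal V := fun b => by
    rw [hϖ.maximalIdeal_eq, Ideal.mem_span_singleton]
  have hβ : Function.Surjective (Sigma.fst : J → Fin k) := fun i =>
    ⟨⟨i, ⟨0, Nat.sub_pos_of_lt (hn i)⟩⟩, rfl⟩
  obtain ⟨H, φ, h1, h2, h3⟩ := exists_factorizations_of_blocks hβ (f₀ := f none)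
    (f := fun x => f (some x)) (a := a) (hf _) (fun x => hf _) (fun x h => by simpa using hdeg h)
    (fun x y h => Option.some_injective _ (hdeg h))
    (fun x => by
      have h4 : evalAt a (f (some x)) ∉ IsLocalRing.maximalIdeal V := by
        rw [hc, hca]
        simp [Z]
      exact not_not.1 h4)
    (ha none) hϖ (by
      intro A
      constructor
      · rintro ⟨G, hG⟩ x hx y hy
        by_contra hxy
        obtain ⟨b, hb, -⟩ := hval (some (x, y))
        have h4 : evalAt b (f none * ∏ x ∈ A, f (some x)) ∈ IsLocalRing.maximalIdeal V := by
          rw [hG, map_mul, evalAt_const]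
          exact Ideal.mul_mem_right _ _ hϖ.not_isUnit
        rw [map_mul, map_prod, hprime.mul_mem_iff_mem_or_mem,
          hprime.prod_mem_iff] at h4
        simp only [hc, hb] at h4
        simp only [Z, Option.elim_some, if_neg hxy] at h4
        rcases h4 with h4 | ⟨z, hz, h4⟩
        · simp at h4
        · simp only [Option.some.injEq] at h4
          rcases h4 with rfl | rfl
          · exact hx hz
          · exact hy hz
      · intro hA
        refine const_dvd_of_forall_dvd_evalAt hϖ.ne_zero fun b => ?_
        rw [hdvd, map_mul, map_prod, hprime.mul_mem_iff_mem_or_mem,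
          hprime.prod_mem_iff]
        simp only [hc]
        rcases hb : c b with _ | ⟨x, y⟩
        · exact Or.inl rfl
        · simp only [Z, Option.elim_some]
          split_ifs with hxy
          · exact Or.inl trivial
          · right
            by_contra! h4
            refine hxy (hA x (fun hx => ?_) y fun hy => ?_)
            · exact (h4 x hx).1 rfl
            · exact (h4 y hy).2 rfl)
  refine ⟨H, φ, fun i => ⟨(h1 i).1, ?_⟩, h2, h3⟩
  rw [(h1 i).2, Fintype.card_congr (Equiv.sigmaSubtype i), Fintype.card_fin]
  have := hn i
  omega
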